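/- Let $p$ be a prime with $p\equiv 3 \pmod 4$, let $n$ be an odd positive integer, let $k$ be a positive divisor of $n$ with $k\neq n$, and put $$d=\frac{p^n+1}{p^k+1}+\frac{p^n-1}{2}.$$ For a map $f:\mathbb{F}_{p^n}\to\mathbb{F}_{p^n}$ on the finite field with $p^n$ elements, the differential uniformity of $f$ is $$\Delta_f=\max_{a\in\mathbb{F}_{p^n}\setminus\{0\},\ b\in\mathbb{F}_{p^n}}\#\{x\in\mathbb{F}_{p^n} : f(x+a)-f(x)=b\}.$$ Then the power function $f(x)=x^d$ on $\mathbb{F}_{p^n}$ satisfies $$\Delta_f=\frac{p^k+1}{2}.$$ -/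

import Mathlib

/-- The number of solutions `x` of `f (x + a) - f x = b`. -/
def differentialCount {F : Type*} [Field F] [Fintype F] [DecidableEq F]
    (f : F → F) (a b : F) : ℕ :=
  (Finset.univ.filter fun x : F => f (x + a) - f x = b).card

/-- The differential uniformity of `f : F → F`: the maximum, over all nonzero `a` and all `b`, of
the number of solutions `x` of `f (x + a) - f x = b`.  (The index set is nonempty.) -/
def differentialUniformity {F : Type*} [Field F] [Fintype F] [DecidableEq F]
    (f : F → F) : ℕ :=
  (Finset.univ.filter fun ab : F × F => ab.1 ≠ 0).sup fun ab => differentialCount f ab.1 ab.2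

open Finset Polynomial

/-! Write q = p^n, Q = p^k = 2j + 1. Since (Q + 1)d ≡ 2 mod q - 1 and d is even, f(±w^(Q+1)) = w²,
and every element is ±w^(Q+1). By scaling take a = 1. With x + 1 = εu^(Q+1) and x = ε'v^(Q+1), the
equation becomes u² - v² = b; put t = u + v, s = u - v, so ts = b.

For b ≠ 0, equal signs give ε(t^Q s + t s^Q) = 2, which fixes the sum and product of t^(2j), s^(2j)
up to ε. As -1 is not a square, ε is fixed too, leaving at most j values of x. Opposite signs give
ε(t^(Q+1) + s^(Q+1)) = 2, which in the same way leaves at most one. Hence the bound j + 1 = (Q +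
1)/2. A generic solution (t, s), available because k ≠ n, attains it. -/

/-- The properties of a finite field `F` with `-1` a nonsquare, and of the exponent `Q = 2 * j + 1` of
a Frobenius map of `F`, on which the count rests: `Q ≡ 3 mod 4`, and raising to the power `Q + 1`
is squaring followed by a permutation of the squares. -/
structure IsOddFrobeniusExponent (F : Type*) [Field F] (j : ℕ) : Prop where
  odd : Odd j
  add_pow : ∀ x y : F, (x + y) ^ (2 * j + 1) = x ^ (2 * j + 1) + y ^ (2 * j + 1)
  not_isSquare_neg_one : ¬ IsSquare (-1 : F)
  isSquare_or_neg : ∀ x : F, IsSquare x ∨ IsSquare (-x)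
  sq_eq_sq_of_pow_eq : ∀ u v : F, u ^ (2 * j + 2) = v ^ (2 * j + 2) → u ^ 2 = v ^ 2
  exists_pow_eq_sq : ∀ a : F, ∃ w : F, w ^ (2 * j + 2) = a ^ 2

namespace IsOddFrobeniusExponent

variable {F : Type*} [Field F] {j : ℕ}

theorem two_ne_zero (h : IsOddFrobeniusExponent F j) : (2 : F) ≠ 0 := by
  intro h2
  exact h.not_isSquare_neg_one ⟨1, by linear_combination -h2⟩

theorem sub_pow (h : IsOddFrobeniusExponent F j) (x y : F) :
    (x - y) ^ (2 * j + 1) = x ^ (2 * j + 1) - y ^ (2 * j + 1) := by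
  have ho : Odd (2 * j + 1) := ⟨j, rfl⟩
  rw [sub_eq_add_neg, h.add_pow, ho.neg_pow, sub_eq_add_neg]

theorem eq_zero_of_sq_eq_neg_sq (h : IsOddFrobeniusExponent F j) {a b : F}
    (hab : a ^ 2 = -b ^ 2) : b = 0 := by
  by_contra hb
  refine h.not_isSquare_neg_one ⟨a / b, ?_⟩
  field_simp
  linear_combination -hab

theorem exists_pow_eq_or (h : IsOddFrobeniusExponent F j) (x : F) :
    ∃ ε w : F, (ε = 1 ∨ ε = -1) ∧ x = ε * w ^ (2 * j + 2) := by
  rcases h.isSquare_or_neg x with ⟨a, ha⟩ | ⟨a, ha⟩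
  · obtain ⟨w, hw⟩ := h.exists_pow_eq_sq a
    exact ⟨1, w, .inl rfl, by rw [ha, hw]; ring⟩
  · obtain ⟨w, hw⟩ := h.exists_pow_eq_sq a
    exact ⟨-1, w, .inr rfl, by rw [hw]; linear_combination -ha⟩

/-- The bilinear form `t ^ Q * s + t * s ^ Q` in the coordinates `t = u + v`, `s = u - v`. -/
theorem pow_mul_add_mul_pow (h : IsOddFrobeniusExponent F j) (u v : F) :
    (u + v) ^ (2 * j + 1) * (u - v) + (u + v) * (u - v) ^ (2 * j + 1) =
      2 * (u ^ (2 * j + 2) - v ^ (2 * j + 2)) := by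
  rw [h.add_pow, h.sub_pow]; ring

/-- A parallelogram law: additivity of the Q-th power cancels the cross terms. It serves the
opposite-sign case. -/
theorem pow_add_pow (h : IsOddFrobeniusExponent F j) (u v : F) :
    (u + v) ^ (2 * j + 2) + (u - v) ^ (2 * j + 2) =
      2 * (u ^ (2 * j + 2) + v ^ (2 * j + 2)) := by
  rw [pow_succ (u + v), pow_succ (u - v), h.add_pow, h.sub_pow]; ring

/-- Two pairs with equal sums and equal products share their elements. -/
theorem eq_or_eq_of_add_of_mul {a b c d : F} (hs : a + b = c + d) (hm : a * b = c * d) :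
    c = a ∨ c = b := by
  have : (c - a) * (c - b) = 0 := by linear_combination (-c) * hs + hm
  rcases mul_eq_zero.1 this with h | h
  · exact .inl (sub_eq_zero.1 h)
  · exact .inr (sub_eq_zero.1 h)

/-- Pairs of squares with equal products cannot have opposite sums. -/
theorem sign_eq_of_add_of_mul (h : IsOddFrobeniusExponent F j) {ε ε' a b c d : F}
    (hε : ε = 1 ∨ ε = -1) (hε' : ε' = 1 ∨ ε' = -1) (hc : c ≠ 0)
    (hs : ε * (a ^ 2 + b ^ 2) = ε' * (c ^ 2 + d ^ 2)) (hm : a ^ 2 * b ^ 2 = c ^ 2 * d ^ 2) :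
    ε = ε' := by
  by_contra hne
  have hopp : ε' = -ε := by
    rcases hε with rfl | rfl <;> rcases hε' with rfl | rfl <;> simp_all
  have hε0 : ε ≠ 0 := by rcases hε with rfl | rfl <;> simp
  have hs' : a ^ 2 + b ^ 2 = -c ^ 2 + -d ^ 2 := by
    apply mul_left_cancel₀ hε0
    rw [hs, hopp]; ring
  rcases eq_or_eq_of_add_of_mul hs' (by rw [hm]; ring) with h1 | h1
  · exact hc (h.eq_zero_of_sq_eq_neg_sq h1.symm)
  · exact hc (h.eq_zero_of_sq_eq_neg_sq h1.symm)

/-! ### Upper bound for the number of solutions -/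

/-- The differences `(x + 1) - x` of two elements in the same class modulo squares. -/
theorem card_same_sign_le [Fintype F] [DecidableEq F] (h : IsOddFrobeniusExponent F j) {b : F}
    (hb : b ≠ 0) (S : Finset F)
    (hS : ∀ x ∈ S, ∃ ε u v : F, (ε = 1 ∨ ε = -1) ∧ x + 1 = ε * u ^ (2 * j + 2) ∧
      x = ε * v ^ (2 * j + 2) ∧ u ^ 2 - v ^ 2 = b) : #S ≤ j := by
  have key : ∀ x ∈ S, ∃ ε t s : F, (ε = 1 ∨ ε = -1) ∧ t * s = b ∧
      ε * b * (t ^ (2 * j) + s ^ (2 * j)) = 2 ∧ x = ε * (((t - s) / 2) ^ 2) ^ (j + 1) := by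
    intro x hx
    obtain ⟨ε, u, v, hε, h1, h0, huv⟩ := hS x hx
    have h2 := h.two_ne_zero
    refine ⟨ε, u + v, u - v, hε, by rw [← huv]; ring, ?_, ?_⟩
    · have := h.pow_mul_add_mul_pow u v
      rw [← huv]
      linear_combination ε * this - 2 * h1 + 2 * h0
    · have : (u + v - (u - v)) / 2 = v := by field_simp; ring
      rw [this, h0]; ring
  rcases S.eq_empty_or_nonempty with rfl | ⟨x₀, hx₀⟩
  · simp
  obtain ⟨ε₀, t₀, s₀, hε₀, hts₀, hT₀, -⟩ := key x₀ hx₀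
  have hjpos : 0 < j := h.odd.pos
  -- With y = t² and s = b / t, the fraction is ((t - s) / 2)² = v². It is unchanged when t and s
  -- are swapped, so y = s² serves equally.
  have hsub : S ⊆ ((nthRoots j (t₀ ^ (2 * j))).toFinset).image
      (fun y : F => ε₀ * ((y - 2 * b + b ^ 2 / y) / 4) ^ (j + 1)) := by
    intro x hx
    obtain ⟨ε, t, s, hε, hts, hT, hxe⟩ := key x hx
    have ht : t ≠ 0 := by rintro rfl; simp at hts; exact hb hts.symm
    have hs : s ≠ 0 := by rintro rfl; simp at hts; exact hb hts.symm
    have hprod : (t ^ j) ^ 2 * (s ^ j) ^ 2 = (t₀ ^ j) ^ 2 * (s₀ ^ j) ^ 2 := by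
      rw [← mul_pow, ← mul_pow, ← mul_pow, ← mul_pow, hts, hts₀]
    have hsum : ε * ((t ^ j) ^ 2 + (s ^ j) ^ 2) = ε₀ * ((t₀ ^ j) ^ 2 + (s₀ ^ j) ^ 2) := by
      apply mul_left_cancel₀ hb
      linear_combination hT - hT₀
    have ht₀ : t₀ ≠ 0 := by rintro rfl; simp at hts₀; exact hb hts₀.symm
    have hee := h.sign_eq_of_add_of_mul hε hε₀ (pow_ne_zero j ht₀) hsum hprod
    subst hee
    have hε0 : ε ≠ 0 := by rcases hε with rfl | rfl <;> simp
    have hsum' := mul_left_cancel₀ hε0 hsum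
    have h4 : (4 : F) ≠ 0 := by
      have : (4 : F) = 2 * 2 := by norm_num
      rw [this]; exact mul_ne_zero h.two_ne_zero h.two_ne_zero
    have h2 := h.two_ne_zero
    rw [mem_image]
    rcases eq_or_eq_of_add_of_mul hsum' hprod with h1 | h1
    · refine ⟨t ^ 2, ?_, ?_⟩
      · rw [Multiset.mem_toFinset, mem_nthRoots hjpos]
        linear_combination -h1
      · rw [hxe, ← hts]
        congr 2
        field_simp
        ring
    · refine ⟨s ^ 2, ?_, ?_⟩
      · rw [Multiset.mem_toFinset, mem_nthRoots hjpos]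
        linear_combination -h1
      · rw [hxe, ← hts]
        congr 2
        field_simp
        ring
  calc #S ≤ _ := card_le_card hsub
    _ ≤ _ := card_image_le
    _ ≤ _ := Multiset.toFinset_card_le _
    _ ≤ j := card_nthRoots _ _

/-- The differences `(x + 1) - x` of two elements in opposite classes modulo squares. -/
theorem card_opposite_sign_le (h : IsOddFrobeniusExponent F j) {b : F}
    (hb : b ≠ 0) (S : Finset F)
    (hS : ∀ x ∈ S, ∃ ε u v : F, (ε = 1 ∨ ε = -1) ∧ x + 1 = ε * u ^ (2 * j + 2) ∧
      x = -ε * v ^ (2 * j + 2) ∧ u ^ 2 - v ^ 2 = b) : #S ≤ 1 := by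
  rw [card_le_one]
  intro x hx y hy
  obtain ⟨ε, u, v, hε, h1, h0, huv⟩ := hS x hx
  obtain ⟨ε', u', v', hε', h1', h0', huv'⟩ := hS y hy
  have h2 := h.two_ne_zero
  have hp : (u + v) * (u - v) = b := by rw [← huv]; ring
  have hp' : (u' + v') * (u' - v') = b := by rw [← huv']; ring
  have hn : u' + v' ≠ 0 := by intro h; rw [h] at hp'; simp at hp'; exact hb hp'.symm
  have hprod : ((u + v) ^ (j + 1)) ^ 2 * ((u - v) ^ (j + 1)) ^ 2 =
      ((u' + v') ^ (j + 1)) ^ 2 * ((u' - v') ^ (j + 1)) ^ 2 := by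
    rw [← mul_pow, ← mul_pow, ← mul_pow, ← mul_pow, hp, hp']
  have hsum : ε * (((u + v) ^ (j + 1)) ^ 2 + ((u - v) ^ (j + 1)) ^ 2) =
      ε' * (((u' + v') ^ (j + 1)) ^ 2 + ((u' - v') ^ (j + 1)) ^ 2) := by
    have e1 := h.pow_add_pow u v
    have e2 := h.pow_add_pow u' v'
    linear_combination ε * e1 - ε' * e2 - 2 * h1 + 2 * h0 + 2 * h1' - 2 * h0'
  have hee := h.sign_eq_of_add_of_mul hε hε' (pow_ne_zero (j + 1) hn) hsum hprod
  subst hee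
  have hε0 : ε ≠ 0 := by rcases hε with rfl | rfl <;> simp
  have hsum' := mul_left_cancel₀ hε0 hsum
  have hv : v ^ 2 = v' ^ 2 := by
    have h4 : (2 * 2 : F) ≠ 0 := mul_ne_zero h2 h2
    have hb2 : (u' + v') ^ 2 * (u' - v') ^ 2 = (u + v) ^ 2 * (u - v) ^ 2 := by
      rw [← mul_pow, ← mul_pow, hp, hp']
    have hn2 : (u' + v') ^ 2 ≠ 0 := pow_ne_zero 2 hn
    rcases eq_or_eq_of_add_of_mul hsum' hprod with h3 | h3
    -- The power t^(Q+1) determines t², then the product gives s², and 4v² = t² + s² - 2b.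
    · have h5 := h.sq_eq_sq_of_pow_eq (u' + v') (u + v) (by linear_combination h3)
      have h6 : (u' - v') ^ 2 = (u - v) ^ 2 := by
        rw [← h5] at hb2; exact mul_left_cancel₀ hn2 hb2
      apply mul_left_cancel₀ h4
      linear_combination -h5 - h6 - 2 * hp + 2 * hp'
    · have h5 := h.sq_eq_sq_of_pow_eq (u' + v') (u - v) (by linear_combination h3)
      have h6 : (u' - v') ^ 2 = (u + v) ^ 2 := by
        rw [← h5, mul_comm ((u + v) ^ 2)] at hb2; exact mul_left_cancel₀ hn2 hb2
      apply mul_left_cancel₀ h4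
      linear_combination -h5 - h6 - 2 * hp + 2 * hp'
  rw [h0, h0']
  have : v ^ (2 * j + 2) = v' ^ (2 * j + 2) := by
    rw [show 2 * j + 2 = 2 * (j + 1) by ring, pow_mul, pow_mul, hv]
  rw [this]

theorem differentialCount_one_le [Fintype F] [DecidableEq F] (h : IsOddFrobeniusExponent F j)
    {f : F → F} (hf : ∀ ε w : F, ε = 1 ∨ ε = -1 → f (ε * w ^ (2 * j + 2)) = w ^ 2) (b : F) :
    differentialCount f 1 b ≤ j + 1 := by
  classical
  have h2 := h.two_ne_zero
  set S := Finset.univ.filter fun x : F => f (x + 1) - f x = b with hSdef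
  have hcount : differentialCount f 1 b = #S := rfl
  have hrep : ∀ x ∈ S, ∃ ε ε' u v : F, (ε = 1 ∨ ε = -1) ∧ (ε' = 1 ∨ ε' = -1) ∧
      x + 1 = ε * u ^ (2 * j + 2) ∧ x = ε' * v ^ (2 * j + 2) ∧ u ^ 2 - v ^ 2 = b := by
    intro x hx
    obtain ⟨ε, u, hε, hu⟩ := h.exists_pow_eq_or (x + 1)
    obtain ⟨ε', v, hε', hv⟩ := h.exists_pow_eq_or x
    refine ⟨ε, ε', u, v, hε, hε', hu, hv, ?_⟩
    have := (mem_filter.1 hx).2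
    rw [hu, hf _ _ hε] at this
    rw [hv, hf _ _ hε'] at this
    exact this
  rw [hcount]
  -- If b = 0, then u² = v² forces x + 1 = ±x, so only x = -1/2 is possible.
  by_cases hb : b = 0
  · have : #S ≤ 1 := by
      have hhalf : ∀ x ∈ S, 2 * x = -1 := by
        intro x hx
        obtain ⟨ε, ε', u, v, hε, hε', hu, hv, huv⟩ := hrep x hx
        have huv2 : u ^ 2 = v ^ 2 := by rw [hb] at huv; exact sub_eq_zero.1 huv
        have hpow : u ^ (2 * j + 2) = v ^ (2 * j + 2) := by
          rw [show 2 * j + 2 = 2 * (j + 1) by ring, pow_mul, pow_mul, huv2]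
        rw [hpow] at hu
        rcases hε with rfl | rfl <;> rcases hε' with rfl | rfl
        · exact absurd (show (1 : F) = 0 by linear_combination hu - hv) one_ne_zero
        · linear_combination hu + hv
        · linear_combination hu + hv
        · exact absurd (show (1 : F) = 0 by linear_combination hu - hv) one_ne_zero
      rw [card_le_one]
      intro x hx y hy
      exact mul_left_cancel₀ h2 ((hhalf x hx).trans (hhalf y hy).symm)
    omega
  · let P : F → Prop := fun x => ∃ ε u v : F, (ε = 1 ∨ ε = -1) ∧ x + 1 = ε * u ^ (2 * j + 2) ∧
      x = ε * v ^ (2 * j + 2) ∧ u ^ 2 - v ^ 2 = b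
    have h1 : #(S.filter P) ≤ j :=
      h.card_same_sign_le hb _ fun x hx => (mem_filter.1 hx).2
    have h3 : #(S.filter fun x => ¬ P x) ≤ 1 := by
      refine h.card_opposite_sign_le hb _ fun x hx => ?_
      obtain ⟨hxS, hxP⟩ := mem_filter.1 hx
      obtain ⟨ε, ε', u, v, hε, hε', hu, hv, huv⟩ := hrep x hxS
      refine ⟨ε, u, v, hε, hu, ?_, huv⟩
      have : ε' = -ε := by
        have hne : ε' ≠ ε := by
          rintro rfl
          exact hxP ⟨ε', u, v, hε, hu, hv, huv⟩
        rcases hε with rfl | rfl <;> rcases hε' with rfl | rfl <;> simp_all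
      rw [← this]; exact hv
    have := card_filter_add_card_filter_not (s := S) P
    omega

/-! ### Lower bound by explicit solutions -/

/-- `λ t, s / λ` with `λ ^ j = 1` yields `j` solutions in the same class modulo squares, and
`t ^ Q * s` yields another one. -/
theorem le_differentialCount_one [Fintype F] [DecidableEq F] (h : IsOddFrobeniusExponent F j)
    {f : F → F} (hf : ∀ ε w : F, ε = 1 ∨ ε = -1 → f (ε * w ^ (2 * j + 2)) = w ^ 2)
    {ζ : F} (hζ : IsPrimitiveRoot ζ j) {t s : F} (ht : t ≠ 0) (hs : s ≠ 0)
    (hne : t ^ (2 * j) ≠ s ^ (2 * j)) (hts : t ^ (2 * j + 1) * s + t * s ^ (2 * j + 1) = 2) :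
    j + 1 ≤ differentialCount f 1 (t * s) := by
  have h2 := h.two_ne_zero
  have hjpos : 0 < j := h.odd.pos
  have hl0 : ∀ l : F, l ^ j = 1 → l ≠ 0 := by
    rintro l hl rfl
    rw [zero_pow hjpos.ne'] at hl
    exact zero_ne_one hl
  let U : F → F := fun l => (l * t + s / l) / 2
  let V : F → F := fun l => (l * t - s / l) / 2
  have hadd : ∀ l : F, U l + V l = l * t := fun l => by
    simp only [U, V]
    rw [← add_div, div_eq_iff h2]; ring
  have hsub : ∀ l : F, U l - V l = s / l := fun l => by
    simp only [U, V]
    rw [← sub_div, div_eq_iff h2]; ring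
  have hUV : ∀ l : F, l ^ j = 1 → U l ^ (2 * j + 2) = V l ^ (2 * j + 2) + 1 := by
    intro l hl
    have hl2 : l ^ (2 * j + 1) = l := by rw [pow_succ, mul_comm 2 j, pow_mul, hl]; ring
    have key := h.pow_mul_add_mul_pow (U l) (V l)
    rw [hadd, hsub, mul_pow, div_pow, hl2] at key
    have hn := hl0 l hl
    have : l * t ^ (2 * j + 1) * (s / l) + l * t * (s ^ (2 * j + 1) / l) = 2 := by
      rw [← hts]; field_simp
    apply mul_left_cancel₀ h2
    linear_combination this - key
  have hUV2 : ∀ l : F, l ^ j = 1 → U l ^ 2 - V l ^ 2 = t * s := by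
    intro l hl
    have hn := hl0 l hl
    have : U l ^ 2 - V l ^ 2 = (U l + V l) * (U l - V l) := by ring
    rw [this, hadd, hsub]; field_simp
  set S := Finset.univ.filter fun x : F => f (x + 1) - f x = t * s with hSdef
  have hcount : differentialCount f 1 (t * s) = #S := rfl
  have hmem : ∀ ε ε' u v x : F, (ε = 1 ∨ ε = -1) → (ε' = 1 ∨ ε' = -1) →
      x + 1 = ε * u ^ (2 * j + 2) → x = ε' * v ^ (2 * j + 2) → u ^ 2 - v ^ 2 = t * s → x ∈ S := by
    intro ε ε' u v x hε hε' hu hv huv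
    refine mem_filter.2 ⟨mem_univ _, ?_⟩
    rw [hu, hf _ _ hε, hv, hf _ _ hε', huv]
  set X := (nthRootsFinset j (1 : F)).image fun l => V l ^ (2 * j + 2) with hX
  have hXcard : #X = j := by
    rw [hX, card_image_of_injOn, hζ.card_nthRootsFinset]
    intro l hl l' hl' hll
    replace hl : l ^ j = 1 := (mem_nthRootsFinset hjpos _).1 hl
    replace hl' : l' ^ j = 1 := (mem_nthRootsFinset hjpos _).1 hl'
    replace hll : V l ^ (2 * j + 2) = V l' ^ (2 * j + 2) := hll
    have hVV := h.sq_eq_sq_of_pow_eq _ _ hll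
    have hUU := h.sq_eq_sq_of_pow_eq (U l) (U l') (by rw [hUV l hl, hUV l' hl', hll])
    -- Equal x fix U² and V², hence the pair (λt, s/λ) up to swap and common sign. Oddness of j
    -- excludes the sign, `hne` the swap.
    have hsame : (l * t) ^ 2 = (l' * t) ^ 2 ∨ (l * t) ^ 2 = (s / l') ^ 2 := by
      rw [← hadd l, ← hadd l', ← hsub l']
      rcases sq_eq_sq_iff_eq_or_eq_neg.1 hVV with e1 | e1 <;>
        rcases sq_eq_sq_iff_eq_or_eq_neg.1 hUU with e2 | e2 <;> rw [e1, e2]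
      · left; ring
      · right; ring
      · right; ring
      · left; ring
    rcases hsame with e | e
    · rcases sq_eq_sq_iff_eq_or_eq_neg.1 e with e | e
      · exact mul_right_cancel₀ ht e
      · have e' : l = -l' := mul_right_cancel₀ ht (by rw [e]; ring)
        rw [e', h.odd.neg_pow, hl'] at hl
        exact absurd (show (2 : F) = 0 by linear_combination -hl) h2
    · exfalso
      apply hne
      have := congrArg (· ^ j) e
      simp only [← pow_mul] at this
      rwa [mul_pow, div_pow, mul_comm 2 j, pow_mul l, hl, pow_mul l', hl', one_pow, one_mul,
        div_one, mul_comm j 2] at this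
  have hXS : X ⊆ S := by
    intro x hx
    obtain ⟨l, hl, rfl⟩ := mem_image.1 hx
    replace hl : l ^ j = 1 := (mem_nthRootsFinset hjpos _).1 hl
    exact hmem 1 1 (U l) (V l) _ (.inl rfl) (.inl rfl) (by rw [hUV l hl]; ring) (by ring)
      (hUV2 l hl)
  -- The extra solution swaps the roles of the two summands: t^Q s = ετ^(Q+1) and t s^Q = εσ^(Q+1)
  -- with τσ = ts, so the sum 2 becomes the opposite-sign equation.
  obtain ⟨ε, τ, hε, hτ⟩ := h.exists_pow_eq_or (t ^ (2 * j + 1) * s)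
  have hεε : ε * ε = 1 := by rcases hε with rfl | rfl <;> ring
  have hτ0 : τ ≠ 0 := by
    rintro rfl
    rw [zero_pow (by omega), mul_zero] at hτ
    exact mul_ne_zero (pow_ne_zero _ ht) hs hτ
  set σ := t * s / τ with hσdef
  have hτσ : τ * σ = t * s := by rw [hσdef]; field_simp
  have hσ : t * s ^ (2 * j + 1) = ε * σ ^ (2 * j + 2) := by
    apply mul_left_cancel₀ (mul_ne_zero (pow_ne_zero (2 * j + 1) ht) hs)
    have e : (τ * σ) ^ (2 * j + 2) = (t * s) ^ (2 * j + 2) := by rw [hτσ]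
    rw [mul_pow, mul_pow] at e
    calc t ^ (2 * j + 1) * s * (t * s ^ (2 * j + 1)) = t ^ (2 * j + 2) * s ^ (2 * j + 2) := by ring
      _ = (ε * ε) * (τ ^ (2 * j + 2) * σ ^ (2 * j + 2)) := by rw [e, hεε, one_mul]
      _ = _ := by rw [hτ]; ring
  set u := (τ + σ) / 2 with hu
  set v := (τ - σ) / 2 with hv
  have huv1 : u + v = τ := by rw [hu, hv]; field_simp; ring
  have huv2 : u - v = σ := by rw [hu, hv]; field_simp; ring
  have huv : ε * u ^ (2 * j + 2) + ε * v ^ (2 * j + 2) = 1 := by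
    have e := h.pow_add_pow u v
    rw [huv1, huv2] at e
    apply mul_left_cancel₀ h2
    linear_combination -ε * e - hτ - hσ + hts
  have hxS : -ε * v ^ (2 * j + 2) ∈ S := by
    refine hmem ε (-ε) u v _ hε ?_ (by linear_combination -huv) rfl ?_
    · rcases hε with rfl | rfl <;> simp
    · rw [← hτσ, ← huv1, ← huv2]; ring
  have hτσne : τ ^ (2 * j + 2) ≠ σ ^ (2 * j + 2) := by
    intro e
    rw [e, ← hσ] at hτ
    apply hne
    apply mul_left_cancel₀ (mul_ne_zero ht hs)
    linear_combination hτ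
  -- A coincidence would equate a square with the negative of a square, forcing v = 0 or u = 0, that
  -- is τ = ±σ.
  have hxX : -ε * v ^ (2 * j + 2) ∉ X := by
    intro hx
    obtain ⟨l, hl, e⟩ := mem_image.1 hx
    replace hl : l ^ j = 1 := (mem_nthRootsFinset hjpos _).1 hl
    have e' := hUV l hl
    rw [e] at e'
    rcases hε with rfl | rfl
    · have hv0 : v ^ (j + 1) = 0 := h.eq_zero_of_sq_eq_neg_sq (a := V l ^ (j + 1))
        (by linear_combination e)
      have : v = 0 := eq_zero_of_pow_eq_zero hv0
      apply hτσne
      rw [← huv1, ← huv2, this]; simp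
    · have hu0 : u ^ (j + 1) = 0 := h.eq_zero_of_sq_eq_neg_sq (a := U l ^ (j + 1))
        (by linear_combination e' - huv)
      have : u = 0 := eq_zero_of_pow_eq_zero hu0
      apply hτσne
      rw [← huv1, ← huv2, this, zero_add, zero_sub, Even.neg_pow ⟨j + 1, by ring⟩]
  calc j + 1 = #(insert (-ε * v ^ (2 * j + 2)) X) := by rw [card_insert_of_notMem hxX, hXcard]
    _ ≤ #S := card_le_card (insert_subset hxS hXS)
    _ = _ := hcount.symm

/-- By homogeneity set t = rs, leaving s^(Q+1) = 2 / (r^Q + r). This is solvable after possibly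
replacing r by -r, and r^Q ≠ r makes the 2j-th powers differ. -/
theorem exists_pow_mul_add_mul_pow_eq_two (h : IsOddFrobeniusExponent F j)
    (hr : ∃ r : F, r ^ (2 * j + 1) ≠ r) : ∃ t s : F, t ≠ 0 ∧ s ≠ 0 ∧
      t ^ (2 * j) ≠ s ^ (2 * j) ∧ t ^ (2 * j + 1) * s + t * s ^ (2 * j + 1) = 2 := by
  have h2 := h.two_ne_zero
  have ho : Odd (2 * j + 1) := ⟨j, rfl⟩
  obtain ⟨r, hr⟩ := hr
  have hz : ∀ r : F, r ≠ 0 → r ^ (2 * j + 1) + r ≠ 0 := by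
    intro r hr0 e
    have : r * ((r ^ j) ^ 2 + 1) = 0 := by linear_combination e
    refine h.not_isSquare_neg_one ⟨r ^ j, ?_⟩
    have := (mul_eq_zero.1 this).resolve_left hr0
    linear_combination -this
  have hr0 : r ≠ 0 := by rintro rfl; exact hr (zero_pow (by omega))
  obtain ⟨r, hr, hr0, s, hs⟩ : ∃ r : F, r ^ (2 * j + 1) ≠ r ∧ r ≠ 0 ∧
      ∃ s : F, s ^ (2 * j + 2) = 2 / (r ^ (2 * j + 1) + r) := by
    rcases h.isSquare_or_neg (2 / (r ^ (2 * j + 1) + r)) with ⟨a, ha⟩ | ⟨a, ha⟩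
    · obtain ⟨w, hw⟩ := h.exists_pow_eq_sq a
      exact ⟨r, hr, hr0, w, by rw [ha, hw, sq]⟩
    · obtain ⟨w, hw⟩ := h.exists_pow_eq_sq a
      refine ⟨-r, by rwa [ho.neg_pow, Ne, neg_inj], neg_ne_zero.2 hr0, w, ?_⟩
      rw [ho.neg_pow, hw, sq, ← ha, ← div_neg]
      congr 1; ring
  have hz' := hz r hr0
  have hs0 : s ≠ 0 := by
    rintro rfl
    rw [zero_pow (by omega)] at hs
    exact div_ne_zero h2 hz' hs.symm
  refine ⟨r * s, s, mul_ne_zero hr0 hs0, hs0, ?_, ?_⟩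
  · intro e
    apply hr
    rw [mul_pow] at e
    have := mul_right_cancel₀ (pow_ne_zero (2 * j) hs0) (e.trans (one_mul _).symm)
    rw [pow_succ, this, one_mul]
  · calc _ = (r ^ (2 * j + 1) + r) * s ^ (2 * j + 2) := by rw [mul_pow]; ring
      _ = 2 := by rw [hs]; field_simp

end IsOddFrobeniusExponent

/-! ### Scaling and finite-field arithmetic -/

theorem differentialCount_pow_eq {F : Type*} [Field F] [Fintype F] [DecidableEq F] (d : ℕ)
    {a : F} (ha : a ≠ 0) (b : F) :
    differentialCount (fun x : F => x ^ d) a b =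
      differentialCount (fun x : F => x ^ d) 1 (b / a ^ d) := by
  unfold differentialCount
  refine card_bij' (fun x _ => x / a) (fun x _ => x * a) ?_ ?_ ?_ ?_
  · intro x hx
    have := (mem_filter.1 hx).2
    refine mem_filter.2 ⟨mem_univ _, ?_⟩
    simp only
    rw [← this, sub_div, ← div_pow, ← div_pow, add_div, div_self ha]
  · intro x hx
    have := (mem_filter.1 hx).2
    refine mem_filter.2 ⟨mem_univ _, ?_⟩
    simp only at this ⊢
    rw [eq_div_iff (pow_ne_zero d ha), sub_mul, ← mul_pow, ← mul_pow, add_mul, one_mul] at this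
    exact this
  · intro x _; simp [ha]
  · intro x _; simp [ha]

/-- The differential uniformity of a power map is attained at `a = 1`. -/
theorem differentialUniformity_pow_eq {F : Type*} [Field F] [Fintype F] [DecidableEq F] {d m : ℕ}
    (hle : ∀ b : F, differentialCount (fun x : F => x ^ d) 1 b ≤ m)
    (hge : ∃ b : F, m ≤ differentialCount (fun x : F => x ^ d) 1 b) :
    differentialUniformity (fun x : F => x ^ d) = m := by
  refine le_antisymm (Finset.sup_le ?_) ?_
  · intro ab hab
    rw [differentialCount_pow_eq d (mem_filter.1 hab).2]
    exact hle _
  · obtain ⟨b, hb⟩ := hge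
    refine hb.trans (Finset.le_sup (f := fun ab : F × F =>
      differentialCount (fun x : F => x ^ d) ab.1 ab.2) (b := (1, b)) ?_)
    exact mem_filter.2 ⟨mem_univ _, one_ne_zero⟩

/-- The quotient of `Q ^ m + 1` by `Q + 1`, for odd `Q` and `m`, is odd. -/
theorem exists_odd_mul_succ_eq_pow_add_one {j m : ℕ} (hm : Odd m) :
    ∃ e : ℕ, Odd e ∧ e * (2 * j + 2) = (2 * j + 1) ^ m + 1 := by
  obtain ⟨i, rfl⟩ := hm
  induction i with
  | zero => exact ⟨1, odd_one, by ring⟩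
  | succ i ih =>
    obtain ⟨e, he, h⟩ := ih
    refine ⟨e + (2 * j + 1) ^ (2 * i + 1) * (2 * j), he.add_even ?_, ?_⟩
    · exact (even_two_mul j).mul_left _
    · rw [add_mul, h]; ring

theorem exists_isPrimitiveRoot_of_dvd {F : Type*} [Field F] [Fintype F] {j : ℕ}
    (hj : j ∣ Fintype.card F - 1) : ∃ ζ : F, IsPrimitiveRoot ζ j := by
  classical
  obtain ⟨g, hg⟩ := IsCyclic.exists_generator (α := Fˣ)
  have ho : orderOf g = Fintype.card F - 1 := by
    rw [orderOf_eq_card_of_forall_mem_zpowers hg, Nat.card_eq_fintype_card, Fintype.card_units]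
  obtain ⟨c, hc⟩ := hj
  have hpos : 0 < Fintype.card F - 1 := Nat.sub_pos_of_lt Fintype.one_lt_card
  have hg' : IsPrimitiveRoot g (Fintype.card F - 1) := ho ▸ IsPrimitiveRoot.orderOf g
  exact ⟨_, IsPrimitiveRoot.coe_units_iff.2 (hg'.pow hpos (hc.trans (mul_comm j c)))⟩

/-- Since e(Q + 1) = q + 1 and w^(q+1) = w², the e-th power sends w^(Q+1) to w². As q ≡ 3 mod 4,
x^((q+1)/2) is a square equal to ±x. -/
theorem isOddFrobeniusExponent_of_card {F : Type*} [Field F] [Fintype F] {p k j m e : ℕ}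
    [CharP F p] (hp : p.Prime) (hj : Odd j) (hQ : p ^ k = 2 * j + 1)
    (hF : Fintype.card F = (2 * j + 1) ^ m) (hF4 : Fintype.card F % 4 = 3)
    (he : e * (2 * j + 2) = (2 * j + 1) ^ m + 1) : IsOddFrobeniusExponent F j where
  odd := hj
  add_pow x y := by
    have := Fact.mk hp
    rw [← hQ, add_pow_char_pow]
  not_isSquare_neg_one := by
    rw [FiniteField.isSquare_neg_one_iff]
    exact fun h => h hF4
  isSquare_or_neg x := by
    obtain ⟨i, hi⟩ : ∃ i, Fintype.card F = 4 * i + 3 := ⟨Fintype.card F / 4, by omega⟩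
    have hx : (x ^ (2 * i + 2)) ^ 2 = x ^ 2 := by
      rw [← pow_mul, show (2 * i + 2) * 2 = Fintype.card F + 1 by omega, pow_succ,
        FiniteField.pow_card, sq]
    have hsq : IsSquare (x ^ (2 * i + 2)) := ⟨x ^ (i + 1), by ring⟩
    rcases sq_eq_sq_iff_eq_or_eq_neg.1 hx with e | e
    · exact .inl (e ▸ hsq)
    · exact .inr (e ▸ hsq)
  sq_eq_sq_of_pow_eq u v huv := by
    have hpow : ∀ w : F, (w ^ (2 * j + 2)) ^ e = w ^ 2 := fun w => by
      rw [← pow_mul, mul_comm, he, ← hF, pow_succ, FiniteField.pow_card, sq]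
    rw [← hpow u, ← hpow v, huv]
  exists_pow_eq_sq a := ⟨a ^ e, by
    rw [← pow_mul, he, ← hF, pow_succ, FiniteField.pow_card, sq]⟩

theorem mainTheorem4 {F : Type*} [Field F] [Fintype F] [DecidableEq F]
    (p n k : ℕ) (hp : p.Prime) (hp4 : p % 4 = 3) (hn : Odd n) (hk : k ∣ n) (hkn : k ≠ n)
    (hF : Fintype.card F = p ^ n) :
    differentialUniformity
        (fun x : F => x ^ ((p ^ n + 1) / (p ^ k + 1) + (p ^ n - 1) / 2)) =
      (p ^ k + 1) / 2 := by
  have := Fact.mk hp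
  have : CharP F p := charP_of_card_eq_prime_pow hF
  have hmod : ∀ i : ℕ, Odd i → p ^ i % 4 = 3 := by
    rintro _ ⟨i, rfl⟩
    rw [Nat.pow_mod, hp4, pow_succ, pow_mul, Nat.mul_mod, Nat.pow_mod]
    norm_num
  obtain ⟨m, rfl⟩ := hk
  obtain ⟨hko, hmo⟩ := Nat.odd_mul.1 hn
  have hQ4 := hmod k hko
  have hq4 := hmod _ hn
  obtain ⟨j, hQ⟩ : ∃ j, p ^ k = 2 * j + 1 := ⟨p ^ k / 2, by omega⟩
  have hj : Odd j := by rw [Nat.odd_iff]; omega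
  obtain ⟨e, heo, he⟩ := exists_odd_mul_succ_eq_pow_add_one (j := j) hmo
  rw [pow_mul, hQ] at hF hq4 ⊢
  have hF4 : Fintype.card F % 4 = 3 := by rw [hF, hq4]
  have h := isOddFrobeniusExponent_of_card hp hj hQ hF hF4 he
  have hdiv : ((2 * j + 1) ^ m + 1) / (2 * j + 1 + 1) = e := by
    rw [← he]; exact Nat.mul_div_cancel _ (by omega)
  rw [hdiv, show (2 * j + 1 + 1) / 2 = j + 1 by omega]
  set d := e + ((2 * j + 1) ^ m - 1) / 2 with hd
  -- Both summands are odd, the second because q ≡ 3 mod 4; evenness makes f blind to the sign ε.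
  have hdeven : Even d := by
    refine heo.add_odd ?_
    rw [Nat.odd_iff]; omega
  have hd2 : (2 * j + 2) * d = Fintype.card F + 1 + (Fintype.card F - 1) * (j + 1) := by
    have h1 : ((2 * j + 1) ^ m - 1) / 2 * 2 = (2 * j + 1) ^ m - 1 :=
      Nat.div_mul_cancel (by omega)
    rw [hd, mul_add, mul_comm _ e, he, hF]
    linear_combination (j + 1) * h1
  have hf : ∀ ε w : F, ε = 1 ∨ ε = -1 → (ε * w ^ (2 * j + 2)) ^ d = w ^ 2 := by
    intro ε w hε
    have hεd : ε ^ d = 1 := by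
      rcases hε with rfl | rfl
      · exact one_pow d
      · exact hdeven.neg_one_pow
    rw [mul_pow, hεd, one_mul, ← pow_mul, hd2, pow_add, pow_succ, FiniteField.pow_card, ← sq]
    rcases eq_or_ne w 0 with rfl | hw
    · simp
    · rw [pow_mul, FiniteField.pow_card_sub_one_eq_one w hw, one_pow, mul_one]
  refine differentialUniformity_pow_eq (fun b => h.differentialCount_one_le hf b) ?_
  have hdvd : 2 * j ∣ Fintype.card F - 1 := by
    rw [hF]
    simpa using Nat.sub_dvd_pow_sub_pow (2 * j + 1) 1 m
  obtain ⟨ζ, hζ⟩ := exists_isPrimitiveRoot_of_dvd ((dvd_mul_left j 2).trans hdvd)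
  -- Here k ≠ n enters: if all r satisfied r^Q = r, then q - 1 would divide Q - 1, although Q < q.
  have hr : ∃ r : F, r ^ (2 * j + 1) ≠ r := by
    by_contra! hall
    have hdvd' : Fintype.card F - 1 ∣ 2 * j := by
      rw [← FiniteField.forall_pow_eq_one_iff F]
      intro x
      have hx := hall x
      rw [pow_succ] at hx
      exact Units.ext (by simpa using mul_right_cancel₀ x.ne_zero (hx.trans (one_mul _).symm))
    have hle := Nat.le_of_dvd (by have := hj.pos; omega) hdvd'
    have hm1 : m ≠ 1 := by rintro rfl; simp at hkn
    have hm2 : 1 < m := by have := hmo.pos; omega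
    have hlt : (2 * j + 1) ^ 1 < (2 * j + 1) ^ m :=
      Nat.pow_lt_pow_right (by have := hj.pos; omega) hm2
    rw [pow_one, ← hF] at hlt
    omega
  obtain ⟨t, s, ht, hs, hne, hts⟩ := h.exists_pow_mul_add_mul_pow_eq_two hr
  exact ⟨t * s, h.le_differentialCount_one hf hζ ht hs hne hts⟩
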